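/- **Labelled transition systems.** Fix a set $\mathcal N$ of names. Visible actions $\mu$ are inputs $a$ and outputs $\bar a$ ($a\in\mathcal N$), with $\overline{\bar a}=a$; actions $\alpha$ are the visible ones and $\tau$. An LTS is a set of states with a relation $p\xrightarrow{\alpha}p'$. A state is stable if it has no $\tau$-transition. An LTS is *image-finite* if $\{p' : p\xrightarrow{\alpha}p'\}$ is finite for all $p,\alpha$. **Output-buffered agents with feedback.** Let $\simeq$ be an equivalence on states that is compatible with transitions ($p\simeq q\xrightarrow{\alpha}q'$ implies $p\xrightarrow{\alpha}p'\simeq q'$ for some $p'$); equality is a possible choice. The LTS is in $\mathrm{Fdb}$ (with respect to $\simeq$) if, with all diagrams closed up to $\simeq$: * *output-commutativity*: $p\xrightarrow{\bar a}p'\xrightarrow{\alpha}q$ implies $p\xrightarrow{\alpha}p''\xrightarrow{\bar a}q'\simeq q$ for some $p'',q'$; * *feedback*: $p\xrightarrow{\bar a}p'\xrightarrow{a}q$ implies $p\xrightarrow{\tau}q'\simeq q$ for some $q'$; * *output-determinacy*: $p\xrightarrow{\bar a}p'$ and $p\xrightarrow{\bar a}p''$ imply $p'\simeq p''$; * *output-tau*: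 $p\xrightarrow{\bar a}p'$ and $p\xrightarrow{\tau}p''$ imply that either $p'\xrightarrow{\tau}q$ and $p''\xrightarrow{\bar a}q'\simeq q$ for some $q,q'$, or $p'\xrightarrow{a}q\simeq p''$ for some $q$; * *output-confluence*: $p\xrightarrow{\bar a}p'$ and $p\xrightarrow{\mu}p''$ with $\mu\neq\bar a$ imply $p'\xrightarrow{\mu}q$ and $p''\xrightarrow{\bar a}q'\simeq q$ for some $q,q'$; * *backward-output-determinacy*: $p'\xrightarrow{\bar a}q'$, $p''\xrightarrow{\bar a}q''$ and $q'\simeq q''$ imply $p'\simeq p''$; * *finite mailboxes*: there is a function $\mathrm{mbox}$ from states to finite multisets of outputs such that $\bar a\in\mathrm{mbox}(p)$ iff $p\xrightarrow{\bar a}$, and $\mathrm{mbox}(p)=\{\bar a\}\uplus\mathrm{mbox}(p')$ whenever $p\xrightarrow{\bar a}p'$. **Must-testing.** A system of a server $p$ and a client $r$ reduces by a $\tau$-step of $p$, by a $\tau$-step of $r$, or by $p\xrightarrow{\mu}p'$ together with $r\xrightarrow{\bar\mu}r'$. A computation is a finite or infinite sequence of reductions; it is maximal if it is infinite or cannot be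 extended. Let $\mathrm{good}$ be a predicate on the states of an LTS $\mathcal L_C$ of clients. Then $p\ \mathrm{must}\ r$ if every maximal computation of the system of $p$ and $r$ visits a state whose client is good, and $p\sqsubseteq_{\mathrm{must}}q$ if for every client $r$ of $\mathcal L_C$, $p\ \mathrm{must}\ r$ implies $q\ \mathrm{must}\ r$. **Forwarding.** For an LTS $\mathcal L$, the states of $\mathrm{FW}(\mathcal L)$ are pairs $p\triangleright M$ of a state $p$ and a finite multiset $M$ of outputs. Its transitions are $p\triangleright M\xrightarrow{\alpha}p'\triangleright M$ and $p\triangleright(\{\bar b\}\uplus M)\xrightarrow{\tau}p''\triangleright M$, whenever $p\xrightarrow{\alpha}p'$ and $p\xrightarrow{b}p''$ in $\mathcal L$, and $p\triangleright(\{\bar a\}\uplus M)\xrightarrow{\bar a}p\triangleright M$ and $p\triangleright M\xrightarrow{a}p\triangleright(\{\bar a\}\uplus M)$. Write $\mathrm{FW}(p)$ for $p\triangleright\varnothing$. **Acceptance-set preorder.** For a finite trace $s$ of visible actions, $p\stackrel{s}{\Rightarrow}p'$ means that $p$ reaches $p'$ by performing the actions of $s$ in order, interleaved with any finite number of $\tau$-transitions.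 Write $p\downarrow$ if every sequence of $\tau$-transitions from $p$ is finite; $p\Downarrow\varepsilon$ if $p\downarrow$; and $p\Downarrow\mu.s$ if $p\downarrow$ and $p'\Downarrow s$ whenever $p\stackrel{\mu}{\Rightarrow}p'$. The ready set $R(p)$ is the set of visible actions that $p$ can perform, and $\mathcal A(p,s)=\{R(p') : p\stackrel{s}{\Rightarrow}p',\ p'\text{ stable}\}$. Then $p\preccurlyeq_{\mathsf{AS}}q$ if for every finite trace $s$ with $p\Downarrow s$: $q\Downarrow s$, and every $X\in\mathcal A(q,s)$ includes some $X'\in\mathcal A(p,s)$. **Client generators.** $\mathcal L_C$ has client generators if there are maps $s\mapsto t_c(s)$ and $(s,E)\mapsto t_a(s,E)$ to client states ($s$ a finite trace, $E$ a finite set of names) such that each $f\in\{t_c\}\cup\{t_a(\cdot,E) : E\}$ satisfies, for all $s,a,\mu,r$: 1. $f(s)$ is not good; 2. $f(\mu.s)\xrightarrow{\bar\mu}r'\simeq f(s)$ for some $r'$; 3. $f(\bar a.s)$ has a $\tau$-transition; 4. $f(\bar a.s)\xrightarrow{\tau}r$ implies that $r$ is good; 5. $f(\bar a.s)\xrightarrow{\mu}r$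 implies $\mu=a$ and $r\simeq f(s)$; and moreover $t_c(\varepsilon)$ has no visible transition, has a $\tau$-transition, and all its $\tau$-transitions lead to good states; and $t_a(\varepsilon,E)$ is stable, performs no output, can input $a$ iff $a\in E$, and all its visible transitions lead to good states. **Theorem.** Let $\mathcal L_A,\mathcal L_B,\mathcal L_C\in\mathrm{Fdb}$ be LTSs over the same names, with $\mathcal L_A$ image-finite, and let $\mathrm{good}$ be a predicate on the states of $\mathcal L_C$ that is preserved by $\simeq$ and satisfies $\mathrm{good}(r)\iff\mathrm{good}(r')$ whenever $r\xrightarrow{\bar a}r'$. Let $p$ be a state of $\mathcal L_A$ and $q$ a state of $\mathcal L_B$. Then $$\mathrm{FW}(p)\preccurlyeq_{\mathsf{AS}}\mathrm{FW}(q)\ \Longrightarrow\ p\sqsubseteq_{\mathrm{must}}q ,$$ and if $\mathcal L_C$ has client generators, then $$p\sqsubseteq_{\mathrm{must}}q\iff\mathrm{FW}(p)\preccurlyeq_{\mathsf{AS}}\mathrm{FW}(q).$$ -/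

import Mathlib

namespace AsyncMust

universe u v w

/-- Visible actions over a set `N` of names: the input `a` and the output `ā`, for `a : N`. -/
inductive VAct (N : Type u) : Type u where
  | inp (a : N) : VAct N
  | out (a : N) : VAct N

/-- Complementation of visible actions. -/
def VAct.co {N : Type u} : VAct N → VAct N
  | .inp a => .out a
  | .out a => .inp a

/-- All actions: the visible ones and the invisible action `τ`. -/
inductive Act (N : Type u) : Type u where
  | vis (μ : VAct N) : Act N
  | tau : Act N

/-- A labelled transition system with states `S` and labels the actions over `N`. -/
structure LTS (S : Type u) (N : Type v) where
  /-- `Tr p α p'` is the transition from `p` to `p'` labelled `α`. -/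
  Tr : S → Act N → S → Prop

section Computations

variable {S : Type u}

/-- `η 0, η 1, …, η len` (all of `η` if `len = ⊤`) is a computation of `s`: a finite or infinite
sequence of `R`-steps that starts in `s`.  Entries of `η` after position `len` are irrelevant. -/
def IsComputation (R : S → S → Prop) (s : S) (len : ℕ∞) (η : ℕ → S) : Prop :=
  η 0 = s ∧ ∀ i : ℕ, (i : ℕ∞) < len → R (η i) (η (i + 1))

/-- A maximal computation: it is infinite, or its last state has no `R`-step. -/
def IsMaximalComputation (R : S → S → Prop) (s : S) (len : ℕ∞) (η : ℕ → S) : Prop :=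
  IsComputation R s len η ∧ ∀ n : ℕ, len = (n : ℕ∞) → ∀ t : S, ¬ R (η n) t

end Computations

namespace LTS

variable {S : Type u} {N : Type v}

/-- Output-buffered agents with feedback (`Fdb`), up to an equivalence `eqv` on states that is
compatible with the transitions (`eqv` may be equality): Selinger's axioms,
backward output determinacy, and the existence of a finite multiset of available outputs. -/
structure IsFdb (L : LTS S N) (eqv : S → S → Prop) : Prop where
  equivalence : Equivalence eqv
  compatible : ∀ (p q q' : S) (α : Act N), eqv p q → L.Tr q α q' →
    ∃ p', L.Tr p α p' ∧ eqv p' q'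
  output_commutativity : ∀ (p p' q : S) (a : N) (α : Act N),
    L.Tr p (.vis (.out a)) p' → L.Tr p' α q →
      ∃ p'' q', L.Tr p α p'' ∧ L.Tr p'' (.vis (.out a)) q' ∧ eqv q' q
  feedback : ∀ (p p' q : S) (a : N),
    L.Tr p (.vis (.out a)) p' → L.Tr p' (.vis (.inp a)) q →
      ∃ q', L.Tr p .tau q' ∧ eqv q' q
  output_determinacy : ∀ (p p' p'' : S) (a : N),
    L.Tr p (.vis (.out a)) p' → L.Tr p (.vis (.out a)) p'' → eqv p' p''
  output_tau : ∀ (p p' p'' : S) (a : N),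
    L.Tr p (.vis (.out a)) p' → L.Tr p .tau p'' →
      (∃ q q', L.Tr p' .tau q ∧ L.Tr p'' (.vis (.out a)) q' ∧ eqv q' q) ∨
      (∃ q, L.Tr p' (.vis (.inp a)) q ∧ eqv q p'')
  output_confluence : ∀ (p p' p'' : S) (a : N) (μ : VAct N), μ ≠ .out a →
    L.Tr p (.vis (.out a)) p' → L.Tr p (.vis μ) p'' →
      ∃ q q', L.Tr p' (.vis μ) q ∧ L.Tr p'' (.vis (.out a)) q' ∧ eqv q' q
  backward_output_determinacy : ∀ (p' p'' q' q'' : S) (a : N),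
    L.Tr p' (.vis (.out a)) q' → L.Tr p'' (.vis (.out a)) q'' → eqv q' q'' → eqv p' p''
  finite_mailbox : ∃ mbox : S → Multiset N,
    (∀ (p : S) (a : N), a ∈ mbox p ↔ ∃ p', L.Tr p (.vis (.out a)) p') ∧
    (∀ (p p' : S) (a : N), L.Tr p (.vis (.out a)) p' → mbox p = a ::ₘ mbox p')

/-- Image-finite LTSs: every state has finitely many `α`-successors, for every action `α`. -/
def ImageFinite (L : LTS S N) : Prop :=
  ∀ (p : S) (α : Act N), {p' : S | L.Tr p α p'}.Finite

/-- A state is stable if it has no `τ`-transition. -/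
def Stable (L : LTS S N) (p : S) : Prop :=
  ∀ p', ¬ L.Tr p .tau p'

/-- Weak transitions along a finite trace of visible actions. -/
inductive Weak (L : LTS S N) : S → List (VAct N) → S → Prop where
  | refl (p : S) : Weak L p [] p
  | tau {p q r : S} {s : List (VAct N)} : L.Tr p .tau q → Weak L q s r → Weak L p s r
  | vis {p q r : S} {μ : VAct N} {s : List (VAct N)} :
      L.Tr p (.vis μ) q → Weak L q s r → Weak L p (μ :: s) r

/-- `p ↓`: every sequence of `τ`-transitions from `p` is finite. -/
def Converges (L : LTS S N) (p : S) : Prop :=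
  ∀ (len : ℕ∞) (η : ℕ → S), IsComputation (fun x y => L.Tr x .tau y) p len η → len ≠ ⊤

/-- `p ⇓ s`: convergence along a finite trace. -/
inductive ConvergesAlong (L : LTS S N) : S → List (VAct N) → Prop where
  | nil {p : S} : L.Converges p → ConvergesAlong L p []
  | cons {p : S} {μ : VAct N} {s : List (VAct N)} : L.Converges p →
      (∀ p', L.Weak p [μ] p' → ConvergesAlong L p' s) → ConvergesAlong L p (μ :: s)

/-- The inputs that `p` can perform. -/
def inputs (L : LTS S N) (p : S) : Set (VAct N) :=
  {μ | ∃ a p', μ = .inp a ∧ L.Tr p (.vis (.inp a)) p'}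

/-- The outputs that `p` can perform. -/
def outputs (L : LTS S N) (p : S) : Set (VAct N) :=
  {μ | ∃ a p', μ = .out a ∧ L.Tr p (.vis (.out a)) p'}

/-- The ready set of `p`. -/
def readySet (L : LTS S N) (p : S) : Set (VAct N) :=
  L.inputs p ∪ L.outputs p

/-- The acceptance set of `p` after the trace `s`: the ready sets of the stable states that `p`
reaches by performing `s`. -/
def acceptanceSet (L : LTS S N) (p : S) (s : List (VAct N)) : Set (Set (VAct N)) :=
  {X | ∃ p', L.Weak p s p' ∧ L.Stable p' ∧ X = L.readySet p'}

/-- The transitions of the lifting `FW`. The mailbox holds finitely many outputs; the output `ā` is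
represented in the multiset by its name `a`. -/
inductive FWTr (L : LTS S N) : S × Multiset N → Act N → S × Multiset N → Prop where
  | proc {p p' : S} {α : Act N} {M : Multiset N} : L.Tr p α p' → FWTr L (p, M) α (p', M)
  | comm {p p' : S} {a : N} {M : Multiset N} :
      L.Tr p (.vis (.inp a)) p' → FWTr L (p, a ::ₘ M) .tau (p', M)
  | mout {p : S} {a : N} {M : Multiset N} : FWTr L (p, a ::ₘ M) (.vis (.out a)) (p, M)
  | minp {p : S} {a : N} {M : Multiset N} : FWTr L (p, M) (.vis (.inp a)) (p, a ::ₘ M)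

/-- The lifting of an LTS to an LTS with forwarding. -/
def FW (L : LTS S N) : LTS (S × Multiset N) N where
  Tr := FWTr L

end LTS

section Preorders

variable {A : Type u} {B : Type v} {N : Type w}

/-- `𝒳 ≪ 𝒴`: every set in `𝒴` includes some set in `𝒳`. -/
def AccLE (X Y : Set (Set (VAct N))) : Prop :=
  ∀ R ∈ Y, ∃ R' ∈ X, R' ⊆ R

/-- `p ≼_cnv q`. -/
def CnvLE (LA : LTS A N) (LB : LTS B N) (p : A) (q : B) : Prop :=
  ∀ s : List (VAct N), LA.ConvergesAlong p s → LB.ConvergesAlong q s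

/-- `p ≼_acc q`. -/
def AccSetLE (LA : LTS A N) (LB : LTS B N) (p : A) (q : B) : Prop :=
  ∀ s : List (VAct N), LA.ConvergesAlong p s →
    AccLE (LA.acceptanceSet p s) (LB.acceptanceSet q s)

/-- Hennessy's preorder `p ≼_AS q`. -/
def ASLE (LA : LTS A N) (LB : LTS B N) (p : A) (q : B) : Prop :=
  CnvLE LA LB p q ∧ AccSetLE LA LB p q

end Preorders

section Testing

variable {P R N : Type*}

/-- The reductions of the systems of a server and a client. -/
inductive SysStep (LP : LTS P N) (LR : LTS R N) : P × R → P × R → Prop where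
  | srv {p p' : P} {r : R} : LP.Tr p .tau p' → SysStep LP LR (p, r) (p', r)
  | clt {p : P} {r r' : R} : LR.Tr r .tau r' → SysStep LP LR (p, r) (p, r')
  | com {p p' : P} {r r' : R} {μ : VAct N} :
      LP.Tr p (.vis μ) p' → LR.Tr r (.vis μ.co) r' → SysStep LP LR (p, r) (p', r')

/-- The server `p` must pass the client `r`: every maximal computation of the system of `p` and `r`
visits a state in which the client is good. -/
def Must (LP : LTS P N) (LR : LTS R N) (good : R → Prop) (p : P) (r : R) : Prop :=
  ∀ (len : ℕ∞) (η : ℕ → P × R), IsMaximalComputation (SysStep LP LR) (p, r) len η →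
    ∃ i : ℕ, (i : ℕ∞) ≤ len ∧ good (η i).2

/-- The `must`-preorder, with respect to the clients of the LTS `LC`. -/
def MustLE {A B C N : Type*} (LA : LTS A N) (LB : LTS B N) (LC : LTS C N) (good : C → Prop)
    (p : A) (q : B) : Prop :=
  ∀ r : C, Must LA LC good p r → Must LB LC good q r

/-- The predicate `good` is preserved by outputs, forwards and backwards, and by `eqv`. -/
structure IsGoodPred (LC : LTS R N) (eqv : R → R → Prop) (good : R → Prop) : Prop where
  out_iff : ∀ (r r' : R) (a : N), LC.Tr r (.vis (.out a)) r' → (good r ↔ good r')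
  eqv_imp : ∀ r r' : R, eqv r r' → good r → good r'

/-- The properties common to both kinds of client generators. -/
structure IsGenerator (LC : LTS R N) (eqv : R → R → Prop) (good : R → Prop)
    (f : List (VAct N) → R) : Prop where
  not_good : ∀ s, ¬ good (f s)
  co_step : ∀ (μ : VAct N) (s : List (VAct N)), ∃ r, LC.Tr (f (μ :: s)) (.vis μ.co) r ∧ eqv r (f s)
  out_tau : ∀ (a : N) (s : List (VAct N)), ∃ r, LC.Tr (f (.out a :: s)) .tau r
  out_tau_good : ∀ (a : N) (s : List (VAct N)) (r : R), LC.Tr (f (.out a :: s)) .tau r → good r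
  out_vis : ∀ (a : N) (s : List (VAct N)) (μ : VAct N) (r : R),
    LC.Tr (f (.out a :: s)) (.vis μ) r → μ = .inp a ∧ eqv r (f s)

/-- Generators of the clients that test convergence along a trace. -/
structure IsConvGenerator (LC : LTS R N) (eqv : R → R → Prop) (good : R → Prop)
    (tc : List (VAct N) → R) : Prop where
  gen : IsGenerator LC eqv good tc
  nil_vis : ∀ (μ : VAct N) (r : R), ¬ LC.Tr (tc []) (.vis μ) r
  nil_tau : ∃ r, LC.Tr (tc []) .tau r
  nil_tau_good : ∀ r, LC.Tr (tc []) .tau r → good r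

/-- Generators of the clients that test acceptance sets; `E` is a finite set of names. -/
structure IsAccGenerator (LC : LTS R N) (eqv : R → R → Prop) (good : R → Prop)
    (ta : List (VAct N) → Finset N → R) : Prop where
  gen : ∀ E : Finset N, IsGenerator LC eqv good (fun s => ta s E)
  nil_stable : ∀ E : Finset N, LC.Stable (ta [] E)
  nil_out : ∀ (E : Finset N) (a : N) (r : R), ¬ LC.Tr (ta [] E) (.vis (.out a)) r
  nil_inp : ∀ (E : Finset N) (a : N), (∃ r, LC.Tr (ta [] E) (.vis (.inp a)) r) ↔ a ∈ E
  nil_vis_good : ∀ (E : Finset N) (μ : VAct N) (r : R), LC.Tr (ta [] E) (.vis μ) r → good r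

/-- The LTS of clients has generators of both kinds. -/
def HasClientGenerators (LC : LTS R N) (eqv : R → R → Prop) (good : R → Prop) : Prop :=
  (∃ tc : List (VAct N) → R, IsConvGenerator LC eqv good tc) ∧
  (∃ ta : List (VAct N) → Finset N → R, IsAccGenerator LC eqv good ta)

end Testing

end AsyncMust

/-!
# The must-preorder and the acceptance-set preorder for output-buffered agents

The argument works with an inductive form of must-testing, `Inevitable`: a server passes a client
if the tree of reductions up to the first visit to a good client is well-founded and has no
deadlocked leaf.

*Forwarding does not change the tests that are passed* (`must_fw_iff`). In a system of `p ▷ M` and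
`r`, the mailbox `M` holds outputs that the client has already handed over. Such a system is
compared with the one of `p` and a client `r₀` that performs the outputs `M` to become `r`
(`LTS.Emits`). The axioms of `Fdb`, applied to the client, say that this relation is a simulation
in both directions: output-commutativity moves a transition of `r` to `r₀`, feedback turns the
reading back of an own message into a `τ`-transition of `r₀`, and the confluence axioms move the
transitions of `r₀` to `r`. The only unmatched step is the handing over of one more output; it
does not affect whether the client is good, and the mailbox of the client bounds how often it can
be repeated. The same comparison between two systems with forwarding (`Inevitable.fw_of_emits`)
shows that outputs `K` pending in the client may be moved to the mailbox of the server: if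
`p ▷ (M ⊎ K)` passes what is left of the client, then `p ▷ M` passes the client.

*Soundness* (`ASLE.mustLE`) holds for any image-finite LTS of servers on the left. The server `q`
is followed against the set of all states that the server `p` may have reached by the same trace.
That set is finite by König's lemma, so the ranks of its members in their well-founded trees of
reductions have a maximum, and this maximum decreases whenever the client moves. Convergence of
`q` bounds the moves of `q` alone, and the comparison of ready sets excludes deadlocks.

*Completeness* (`asle_fw_of_mustLE_fw`): a client generator `f` reduces the test `f s` to the test
`f []` for all derivatives after `s`, together with convergence along `s`
(`IsGenerator.inevitable`, `IsGenerator.convergesAlong_of_inevitable`). A violation of the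
acceptance condition by a stable derivative of `q` is detected by the client for the finite set of
outputs that derivatives of `p` after `s` offer and that derivative of `q` does not; inputs play
no role because a server with forwarding can always perform them.
-/

namespace AsyncMust

/-! ### Inevitability -/

section Inevitability

variable {S T : Type*} {R : S → S → Prop} {G : S → Prop}

/-- `Inevitable R G x`: every maximal sequence of `R`-steps from `x` visits a state in `G`,
expressed as an induction on the well-founded tree of the `R`-steps before such a visit. -/
inductive Inevitable (R : S → S → Prop) (G : S → Prop) : S → Prop where
  | now {x : S} : G x → Inevitable R G x
  | later {x : S} : (∃ y, R x y) → (∀ y, R x y → Inevitable R G y) → Inevitable R G x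

theorem Inevitable.step {x y : S} (h : Inevitable R G x) (hx : ¬ G x) (hxy : R x y) :
    Inevitable R G y := by
  cases h with
  | now h => exact absurd h hx
  | later _ h => exact h y hxy

theorem Inevitable.exists_step {x : S} (h : Inevitable R G x) (hx : ¬ G x) : ∃ y, R x y := by
  cases h with
  | now h => exact absurd h hx
  | later h _ => exact h

theorem Inevitable.exists_of_isMaximalComputation {x : S} (h : Inevitable R G x) :
    ∀ (len : ℕ∞) (η : ℕ → S), IsMaximalComputation R x len η →
      ∃ i : ℕ, (i : ℕ∞) ≤ len ∧ G (η i) := by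
  induction h with
  | now hx =>
    rintro len η ⟨⟨rfl, -⟩, -⟩
    exact ⟨0, by simp, hx⟩
  | @later x hstep _ ih =>
    rintro len η ⟨⟨rfl, hη⟩, hmax⟩
    obtain ⟨len', rfl⟩ : ∃ len' : ℕ∞, len = len' + 1 := by
      induction len using ENat.recTopCoe with
      | top => exact ⟨⊤, by simp⟩
      | coe n =>
        cases n with
        | zero =>
          obtain ⟨y, hy⟩ := hstep
          exact absurd hy (hmax 0 rfl y)
        | succ n => exact ⟨n, by simp⟩
    obtain ⟨i, hi, hg⟩ := ih (η 1) (hη 0 (by simp)) len' (fun i => η (i + 1))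
      ⟨⟨rfl, fun i hi => hη (i + 1) (by
        push_cast
        exact (ENat.add_lt_add_iff_right (by simp)).2 hi)⟩,
        fun n hn t => hmax (n + 1) (by simp [hn]) t⟩
    exact ⟨i + 1, by push_cast; gcongr, hg⟩

/-- Inevitability agrees with its formulation by maximal computations: from a state where `G` is
not inevitable, a maximal computation through such states is obtained by iterated choice. -/
theorem inevitable_iff {x : S} :
    Inevitable R G x ↔ ∀ (len : ℕ∞) (η : ℕ → S), IsMaximalComputation R x len η →
      ∃ i : ℕ, (i : ℕ∞) ≤ len ∧ G (η i) := by
  classical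
  refine ⟨Inevitable.exists_of_isMaximalComputation, fun h => ?_⟩
  by_contra hx
  have key : ∀ y, ¬ Inevitable R G y →
      ¬ G y ∧ ((∃ z, R y z) → ∃ z, R y z ∧ ¬ Inevitable R G z) := by
    refine fun y hy => ⟨fun hg => hy (.now hg), fun hz => ?_⟩
    by_contra! hall
    exact hy (.later hz hall)
  let next : S → S := fun y =>
    if hy : ∃ z, R y z ∧ ¬ Inevitable R G z then hy.choose else y
  have hnext : ∀ y, ¬ Inevitable R G y → ¬ Inevitable R G (next y) := by
    intro y hy
    simp only [next]
    split_ifs with hz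
    · exact hz.choose_spec.2
    · exact hy
  have hnextR : ∀ y, ¬ Inevitable R G y → (∃ z, R y z) → R y (next y) := by
    intro y hy hz
    have hz' := (key y hy).2 hz
    simp only [next, dif_pos hz']
    exact hz'.choose_spec.1
  let η : ℕ → S := fun n => next^[n] x
  have hη : ∀ n, ¬ Inevitable R G (η n) := by
    intro n
    induction n with
    | zero => exact hx
    | succ n ih =>
      simp only [η, Function.iterate_succ_apply']
      exact hnext _ ih
  have hηR : ∀ n, (∃ z, R (η n) z) → R (η n) (η (n + 1)) := by
    intro n hn
    have := hnextR _ (hη n) hn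
    simpa only [η, Function.iterate_succ_apply'] using this
  by_cases hstuck : ∃ n, ∀ z, ¬ R (η n) z
  · obtain ⟨i, -, hi⟩ := h (Nat.find hstuck : ℕ) η
      ⟨⟨rfl, fun i hi => hηR i (by
        have := Nat.find_min hstuck (Nat.cast_lt.1 hi)
        push Not at this
        exact this)⟩, fun n hn => by
        rw [← Nat.cast_injective hn]
        exact Nat.find_spec hstuck⟩
    exact (key _ (hη i)).1 hi
  · push Not at hstuck
    obtain ⟨i, -, hi⟩ := h ⊤ η ⟨⟨rfl, fun i _ => hηR i (hstuck i)⟩, fun n hn => by simp at hn⟩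
    exact (key _ (hη i)).1 hi

/-- Inevitability is inherited along a simulation `B` that may stutter on either side: `z` may
have to move before its ability to step says anything about `x`, and `x` may make finitely
many steps, as bounded by `m`, that `z` does not match. -/
theorem Inevitable.of_simulation {R' : T → T → Prop} {G' : T → Prop} (B : S → T → Prop)
    (m : S → T → ℕ) (hG : ∀ x z, B x z → G' z → G x)
    (hprog : ∀ x z, B x z → (∃ z', R' z z') → (∃ x', R x x') ∨ ∃ z', R' z z' ∧ B x z')
    (hstep : ∀ x z x', B x z → R x x' →
      (∃ z', R' z z' ∧ B x' z') ∨ (B x' z ∧ m x' z < m x z))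
    {x : S} {z : T} (hz : Inevitable R' G' z) (hB : B x z) : Inevitable R G x := by
  induction hz generalizing x with
  | now hg => exact .now (hG _ _ hB hg)
  | @later z hz _ ih =>
    induction hm : m x z using Nat.strong_induction_on generalizing x with
    | _ k ihk =>
      rcases hprog x z hB hz with hx | ⟨z', hzz', hB'⟩
      · refine .later hx fun x' hx' => ?_
        rcases hstep x z x' hB hx' with ⟨z', hzz', hB'⟩ | ⟨hB', hlt⟩
        · exact ih z' hzz' hB'
        · exact ihk _ (hm ▸ hlt) hB' rfl
      · exact ih z' hzz' hB'

end Inevitability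

theorem must_iff_inevitable {P C N : Type*} {LP : LTS P N} {LC : LTS C N} {good : C → Prop}
    {p : P} {r : C} :
    Must LP LC good p r ↔ Inevitable (SysStep LP LC) (fun x => good x.2) (p, r) := by
  rw [inevitable_iff, Must]

/-! ### Weak transitions and convergence -/

namespace LTS

variable {S N : Type*} {L : LTS S N}

theorem converges_iff_acc {p : S} : L.Converges p ↔ Acc (fun y x => L.Tr x .tau y) p := by
  rw [acc_iff_isEmpty_descending_chain]
  constructor
  · exact fun h => ⟨fun ⟨f, h0, hf⟩ => h ⊤ f ⟨h0, fun i _ => hf i⟩ rfl⟩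
  · rintro ⟨h⟩ len η ⟨h0, hη⟩ rfl
    exact h ⟨η, h0, fun i => hη i (by simp)⟩

theorem Converges.tau {p p' : S} (h : L.Converges p) (hp : L.Tr p .tau p') : L.Converges p' :=
  converges_iff_acc.2 ((converges_iff_acc.1 h).inv hp)

theorem ConvergesAlong.converges {p : S} {s : List (VAct N)} (h : L.ConvergesAlong p s) :
    L.Converges p := by
  cases h <;> assumption

theorem ConvergesAlong.tau {p p' : S} {s : List (VAct N)} (h : L.ConvergesAlong p s)
    (hp : L.Tr p .tau p') : L.ConvergesAlong p' s := by
  cases h with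
  | nil h => exact .nil (h.tau hp)
  | cons h hs => exact .cons (h.tau hp) fun x hx => hs x (.tau hp hx)

theorem ConvergesAlong.weak {p p' : S} {μ : VAct N} {s : List (VAct N)}
    (h : L.ConvergesAlong p (μ :: s)) (hp : L.Weak p [μ] p') : L.ConvergesAlong p' s := by
  cases h with
  | cons _ hs => exact hs p' hp

theorem ConvergesAlong.vis {p p' : S} {μ : VAct N} {s : List (VAct N)}
    (h : L.ConvergesAlong p (μ :: s)) (hp : L.Tr p (.vis μ) p') : L.ConvergesAlong p' s :=
  h.weak (.vis hp (.refl _))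

theorem Weak.append {p q r : S} {s t : List (VAct N)} (h : L.Weak p s q) (h' : L.Weak q t r) :
    L.Weak p (s ++ t) r := by
  induction h with
  | refl => exact h'
  | tau hp _ ih => exact .tau hp (ih h')
  | vis hp _ ih => exact .vis hp (ih h')

theorem weak_cons_iff {p q : S} {μ : VAct N} {s : List (VAct N)} :
    L.Weak p (μ :: s) q ↔ ∃ p', L.Weak p [μ] p' ∧ L.Weak p' s q := by
  constructor
  · intro h
    generalize ht : μ :: s = t at h
    induction h with
    | refl => cases ht
    | tau hp _ ih =>
      obtain ⟨p', h1, h2⟩ := ih ht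
      exact ⟨p', .tau hp h1, h2⟩
    | vis hp h _ =>
      cases ht
      exact ⟨_, .vis hp (.refl _), h⟩
  · rintro ⟨p', h1, h2⟩
    exact h1.append h2

theorem weak_singleton_iff {p q : S} {μ : VAct N} :
    L.Weak p [μ] q ↔ ∃ p₁ p₂, L.Weak p [] p₁ ∧ L.Tr p₁ (.vis μ) p₂ ∧ L.Weak p₂ [] q := by
  constructor
  · intro h
    generalize ht : [μ] = t at h
    induction h with
    | refl => cases ht
    | tau hp _ ih =>
      obtain ⟨p₁, p₂, h1, h2, h3⟩ := ih ht
      exact ⟨p₁, p₂, .tau hp h1, h2, h3⟩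
    | vis hp h _ =>
      cases ht
      exact ⟨_, _, .refl _, hp, h⟩
  · rintro ⟨p₁, p₂, h1, h2, h3⟩
    exact h1.append (.vis h2 h3)

theorem Converges.exists_stable {p : S} (h : L.Converges p) :
    ∃ p', L.Weak p [] p' ∧ L.Stable p' := by
  rw [converges_iff_acc] at h
  induction h with
  | intro p _ ih =>
    by_cases hp : L.Stable p
    · exact ⟨p, .refl p, hp⟩
    · simp only [Stable, not_forall, not_not] at hp
      obtain ⟨p', hp'⟩ := hp
      obtain ⟨x, hx, hs⟩ := ih p' hp'
      exact ⟨x, .tau hp' hx, hs⟩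

theorem ConvergesAlong.converges_of_weak {p p' : S} {s : List (VAct N)}
    (h : L.ConvergesAlong p s) (hp : L.Weak p s p') : L.Converges p' := by
  induction hp with
  | refl => exact h.converges
  | tau hp _ ih => exact ih (h.tau hp)
  | vis hp _ ih => exact ih (h.vis hp)

/-- König's lemma for the tree of `τ`-transitions. -/
theorem ImageFinite.finite_weak_nil (hfin : L.ImageFinite) {p : S} (h : L.Converges p) :
    {p' | L.Weak p [] p'}.Finite := by
  rw [converges_iff_acc] at h
  induction h with
  | intro p _ ih =>
    have : {p' | L.Weak p [] p'} ⊆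
        {p} ∪ ⋃ x ∈ {x | L.Tr p .tau x}, {p' | L.Weak x [] p'} := by
      intro p' hp'
      cases hp' with
      | refl => simp
      | tau hx hp' => exact Or.inr (Set.mem_biUnion hx hp')
    exact ((Set.finite_singleton p).union ((hfin p .tau).biUnion ih)).subset this

theorem ImageFinite.finite_weak_singleton (hfin : L.ImageFinite) {p : S} {μ : VAct N}
    (h : L.ConvergesAlong p [μ]) : {p' | L.Weak p [μ] p'}.Finite := by
  have : {p' | L.Weak p [μ] p'} ⊆ ⋃ x ∈ {x | L.Weak p [] x},
      ⋃ y ∈ {y | L.Tr x (.vis μ) y ∧ L.Weak p [μ] y}, {p' | L.Weak y [] p'} := by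
    intro p' hp'
    obtain ⟨x, y, hx, hy, hp'⟩ := weak_singleton_iff.1 hp'
    simp only [Set.mem_iUnion]
    exact ⟨x, hx, y, ⟨hy, weak_singleton_iff.2 ⟨x, y, hx, hy, .refl y⟩⟩, hp'⟩
  exact ((hfin.finite_weak_nil h.converges).biUnion fun x _ =>
    ((hfin x (.vis μ)).subset fun y hy => hy.1).biUnion fun y hy =>
      hfin.finite_weak_nil (h.weak hy.2).converges).subset this

theorem ImageFinite.finite_weak (hfin : L.ImageFinite) {p : S} {s : List (VAct N)}
    (h : L.ConvergesAlong p s) : {p' | L.Weak p s p'}.Finite := by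
  induction s generalizing p with
  | nil => exact hfin.finite_weak_nil h.converges
  | cons μ s ih =>
    have : {p' | L.Weak p (μ :: s) p'} =
        ⋃ x ∈ {x | L.Weak p [μ] x}, {p' | L.Weak x s p'} := by
      ext p'
      rw [Set.mem_ofPred_eq, weak_cons_iff]
      simp
    rw [this]
    refine (hfin.finite_weak_singleton ?_).biUnion fun x hx => ih (h.weak hx)
    exact .cons h.converges fun x hx => .nil (h.weak hx).converges

theorem ImageFinite.fw (hfin : L.ImageFinite) : L.FW.ImageFinite := by
  rintro ⟨p, M⟩ α
  have hM : {a | a ∈ M}.Finite := by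
    classical
    exact M.toFinset.finite_toSet.subset fun a ha => by simpa using ha
  have hproc := (hfin p α).image fun p' => (p', M)
  have hE : {x : S × Multiset N | ∃ a M', M = a ::ₘ M' ∧
      (x.2 = M' ∧ (x.1 = p ∨ L.Tr p (.vis (.inp a)) x.1))}.Finite := by
    classical
    refine (hM.biUnion fun a _ => (((Set.finite_singleton p).union
      (hfin p (.vis (.inp a)))).image fun p' => (p', M.erase a))).subset ?_
    rintro ⟨x, K⟩ ⟨a, M', rfl, rfl, hx⟩
    exact Set.mem_biUnion (x := a) (by simp) ⟨x, hx, by simp⟩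
  have hminp : {x : S × Multiset N | ∃ a, α = .vis (.inp a) ∧ x = (p, a ::ₘ M)}.Finite := by
    refine Set.Subsingleton.finite ?_
    rintro x ⟨a, ha, rfl⟩ y ⟨b, hb, rfl⟩
    cases ha.symm.trans hb
    rfl
  refine ((hproc.union hE).union hminp).subset ?_
  intro x hx
  change FWTr L (p, M) α x at hx
  cases hx with
  | proc h => exact Or.inl (Or.inl ⟨_, h, rfl⟩)
  | comm h => exact Or.inl (Or.inr ⟨_, _, rfl, rfl, Or.inr h⟩)
  | mout => exact Or.inl (Or.inr ⟨_, _, rfl, rfl, Or.inl rfl⟩)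
  | minp => exact Or.inr ⟨_, rfl, rfl⟩

end LTS

/-! ### Emitting a multiset of outputs -/

namespace LTS

variable {S N : Type*} {L : LTS S N} {eqv : S → S → Prop}

/-- `L.Emits eqv r M r'`: up to `eqv`, the state `r` reaches `r'` by performing the outputs in
`M`, in some order and with no other transitions in between. -/
inductive Emits (L : LTS S N) (eqv : S → S → Prop) : S → Multiset N → S → Prop where
  | refl {r r' : S} : eqv r r' → Emits L eqv r 0 r'
  | cons {r r₁ r' : S} {a : N} {M : Multiset N} :
      L.Tr r (.vis (.out a)) r₁ → Emits L eqv r₁ M r' → Emits L eqv r (a ::ₘ M) r'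

namespace IsFdb

variable (h : L.IsFdb eqv)

include h

theorem emits_refl (r : S) : L.Emits eqv r 0 r := .refl (h.equivalence.refl r)

theorem emits_of_eqv_left {r x r' : S} {M : Multiset N} (hr : eqv r x) (hx : L.Emits eqv x M r') :
    L.Emits eqv r M r' := by
  induction hx generalizing r with
  | refl hx => exact .refl (h.equivalence.trans hr hx)
  | cons hx _ ih =>
    obtain ⟨x', hx', he⟩ := h.compatible _ _ _ _ hr hx
    exact .cons hx' (ih he)

/-- A transition after some outputs can be performed before them. -/
theorem exists_tr_emits_of_emits {r r' r'' : S} {M : Multiset N} {α : Act N}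
    (hr : L.Emits eqv r M r') (hr' : L.Tr r' α r'') :
    ∃ x, L.Tr r α x ∧ L.Emits eqv x M r'' := by
  induction hr with
  | refl hr =>
    obtain ⟨x, hx, he⟩ := h.compatible _ _ _ _ hr hr'
    exact ⟨x, hx, .refl he⟩
  | cons hr _ ih =>
    obtain ⟨x₁, hx₁, hM⟩ := ih hr'
    obtain ⟨x, q', hx, hq', he⟩ := h.output_commutativity _ _ _ _ _ hr hx₁
    exact ⟨x, hx, .cons hq' (h.emits_of_eqv_left he hM)⟩

theorem emits_concat {r r' r'' : S} {M : Multiset N} {a : N}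
    (hr : L.Emits eqv r M r') (hr' : L.Tr r' (.vis (.out a)) r'') :
    L.Emits eqv r (a ::ₘ M) r'' := by
  obtain ⟨x, hx, hM⟩ := h.exists_tr_emits_of_emits hr hr'
  exact .cons hx hM

/-- Any of the outputs of a multiset can be performed first. -/
theorem exists_tr_out_of_emits_cons {r r' : S} {M : Multiset N} {a : N}
    (hr : L.Emits eqv r (a ::ₘ M) r') :
    ∃ x, L.Tr r (.vis (.out a)) x ∧ L.Emits eqv x M r' := by
  generalize hK : a ::ₘ M = K at hr
  induction hr generalizing M with
  | refl => simp at hK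
  | cons hr hM ih =>
    rcases Multiset.cons_eq_cons.1 hK with ⟨rfl, rfl⟩ | ⟨-, K', rfl, rfl⟩
    · exact ⟨_, hr, hM⟩
    · obtain ⟨x₁, hx₁, hM'⟩ := ih rfl
      obtain ⟨x, q', hx, hq', he⟩ := h.output_commutativity _ _ _ _ _ hr hx₁
      exact ⟨x, hx, .cons hq' (h.emits_of_eqv_left he hM')⟩

theorem emits_of_emits_cons {r r₁ r' : S} {M : Multiset N} {a : N}
    (hr : L.Emits eqv r (a ::ₘ M) r') (hr₁ : L.Tr r (.vis (.out a)) r₁) :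
    L.Emits eqv r₁ M r' := by
  obtain ⟨x, hx, hM⟩ := h.exists_tr_out_of_emits_cons hr
  exact h.emits_of_eqv_left (h.output_determinacy _ _ _ _ hr₁ hx) hM

/-- Visible transitions are not affected by other outputs. -/
theorem exists_tr_vis_of_emits {r r' r₁ : S} {M : Multiset N} {μ : VAct N}
    (hr : L.Emits eqv r M r') (hμ : ∀ a ∈ M, μ ≠ .out a) (hr₁ : L.Tr r (.vis μ) r₁) :
    ∃ x, L.Tr r' (.vis μ) x ∧ L.Emits eqv r₁ M x := by
  induction hr generalizing r₁ with
  | refl hr =>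
    obtain ⟨x, hx, he⟩ := h.compatible _ _ _ _ (h.equivalence.symm hr) hr₁
    exact ⟨x, hx, .refl (h.equivalence.symm he)⟩
  | cons hr _ ih =>
    obtain ⟨q, q', hq, hq', he⟩ := h.output_confluence _ _ _ _ _ (hμ _ (by simp)) hr hr₁
    obtain ⟨x, hx, hM⟩ := ih (fun a ha => hμ a (Multiset.mem_cons_of_mem ha)) hq
    exact ⟨x, hx, .cons hq' (h.emits_of_eqv_left he hM)⟩

/-- A `τ`-transition is still possible after some outputs, unless it is a feedback, in which case
the output that it consumes can be read back as an input. -/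
theorem exists_tr_of_emits_of_tr_tau {r r' r₁ : S} {M : Multiset N}
    (hr : L.Emits eqv r M r') (hr₁ : L.Tr r .tau r₁) :
    (∃ x, L.Tr r' .tau x ∧ L.Emits eqv r₁ M x) ∨
      ∃ a K x, M = a ::ₘ K ∧ L.Tr r' (.vis (.inp a)) x ∧ L.Emits eqv r₁ K x := by
  induction hr generalizing r₁ with
  | refl hr =>
    obtain ⟨x, hx, he⟩ := h.compatible _ _ _ _ (h.equivalence.symm hr) hr₁
    exact Or.inl ⟨x, hx, .refl (h.equivalence.symm he)⟩
  | @cons _ _ _ a M hr hM ih =>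
    rcases h.output_tau _ _ _ _ hr hr₁ with ⟨q, q', hq, hq', he⟩ | ⟨q, hq, he⟩
    · rcases ih hq with ⟨x, hx, hK⟩ | ⟨b, K, x, rfl, hx, hK⟩
      · exact Or.inl ⟨x, hx, .cons hq' (h.emits_of_eqv_left he hK)⟩
      · exact Or.inr ⟨b, a ::ₘ K, x, Multiset.cons_swap _ _ _, hx,
          .cons hq' (h.emits_of_eqv_left he hK)⟩
    · obtain ⟨x, hx, hK⟩ := h.exists_tr_vis_of_emits hM (by simp) hq
      exact Or.inr ⟨a, M, x, rfl, hx, h.emits_of_eqv_left (h.equivalence.symm he) hK⟩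

/-- An input that follows the corresponding output is a feedback. -/
theorem exists_tr_tau_of_emits_cons {r r' r'' : S} {M : Multiset N} {a : N}
    (hr : L.Emits eqv r (a ::ₘ M) r') (hr' : L.Tr r' (.vis (.inp a)) r'') :
    ∃ x, L.Tr r .tau x ∧ L.Emits eqv x M r'' := by
  obtain ⟨r₁, hr₁, hM⟩ := h.exists_tr_out_of_emits_cons hr
  obtain ⟨y, hy, hM'⟩ := h.exists_tr_emits_of_emits hM hr'
  obtain ⟨x, hx, he⟩ := h.feedback _ _ _ _ hr₁ hy
  exact ⟨x, hx, h.emits_of_eqv_left he hM'⟩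

end IsFdb

end LTS

theorem IsGoodPred.good_iff_of_emits {S N : Type*} {L : LTS S N} {eqv : S → S → Prop}
    {good : S → Prop} (hg : IsGoodPred L eqv good) (he : Equivalence eqv) {r r' : S}
    {M : Multiset N} (h : L.Emits eqv r M r') : good r ↔ good r' := by
  induction h with
  | refl h => exact ⟨hg.eqv_imp _ _ h, hg.eqv_imp _ _ (he.symm h)⟩
  | cons h _ ih => exact (hg.out_iff _ _ _ h).trans ih

/-! ### Forwarding preserves the tests that are passed -/

section Forwarding

variable {P C N : Type*} {LP : LTS P N} {LC : LTS C N} {eqv : C → C → Prop} {good : C → Prop}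

/-- A reduction of the server and the client `r₀` is matched after the client has handed the
outputs `K` over to the mailbox of the server. -/
theorem SysStep.fw_of_emits (hC : LC.IsFdb eqv) {p p' : P} {r₀ r₀' r : C} {K : Multiset N}
    (h : SysStep LP LC (p, r₀) (p', r₀')) (hK : LC.Emits eqv r₀ K r) (M : Multiset N) :
    ∃ K' r', SysStep LP.FW LC ((p, M + K), r) ((p', M + K'), r') ∧ LC.Emits eqv r₀' K' r' := by
  cases h with
  | srv h => exact ⟨K, r, .srv (.proc h), hK⟩
  | clt h =>
    rcases hC.exists_tr_of_emits_of_tr_tau hK h with ⟨x, hx, hK'⟩ | ⟨a, K', x, rfl, hx, hK'⟩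
    · exact ⟨K, x, .clt hx, hK'⟩
    · refine ⟨K', x, ?_, hK'⟩
      rw [Multiset.add_cons]
      exact .com (μ := .out a) .mout hx
  | @com _ _ _ _ μ hp hr =>
    by_cases hμ : ∀ a ∈ K, μ.co ≠ .out a
    · obtain ⟨x, hx, hK'⟩ := hC.exists_tr_vis_of_emits hK hμ hr
      exact ⟨K, x, .com (.proc hp) hx, hK'⟩
    · push Not at hμ
      obtain ⟨a, ha, hμ⟩ := hμ
      obtain ⟨K', rfl⟩ := Multiset.exists_cons_of_mem ha
      cases μ with
      | out b => cases hμ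
      | inp b =>
        cases hμ
        refine ⟨K', r, ?_, hC.emits_of_emits_cons hK hr⟩
        rw [Multiset.add_cons]
        exact .srv (.comm hp)

/-- A reduction with forwarding is matched by a reduction of the original server and the client
`r₀` that still holds the mailbox `M`, unless it is an output of the client, which changes
nothing on the original side. -/
theorem SysStep.of_fw_of_emits (hC : LC.IsFdb eqv) {p p' : P} {r₀ r r' : C} {M M' : Multiset N}
    (h : SysStep LP.FW LC ((p, M), r) ((p', M'), r')) (hM : LC.Emits eqv r₀ M r) :
    (∃ r₀', SysStep LP LC (p, r₀) (p', r₀') ∧ LC.Emits eqv r₀' M' r') ∨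
      (p' = p ∧ (∃ a, LC.Tr r (.vis (.out a)) r') ∧ LC.Emits eqv r₀ M' r') := by
  cases h with
  | srv h =>
    change LTS.FWTr LP _ _ _ at h
    cases h with
    | proc h => exact Or.inl ⟨r₀, .srv h, hM⟩
    | comm h =>
      obtain ⟨x, hx, hM'⟩ := hC.exists_tr_out_of_emits_cons hM
      exact Or.inl ⟨x, .com h hx, hM'⟩
  | clt h =>
    obtain ⟨x, hx, hM'⟩ := hC.exists_tr_emits_of_emits hM h
    exact Or.inl ⟨x, .clt hx, hM'⟩
  | com hp hr =>
    change LTS.FWTr LP _ _ _ at hp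
    cases hp with
    | proc hp =>
      obtain ⟨x, hx, hM'⟩ := hC.exists_tr_emits_of_emits hM hr
      exact Or.inl ⟨x, .com hp hx, hM'⟩
    | mout =>
      obtain ⟨x, hx, hM'⟩ := hC.exists_tr_tau_of_emits_cons hM hr
      exact Or.inl ⟨x, .clt hx, hM'⟩
    | minp => exact Or.inr ⟨rfl, ⟨_, hr⟩, hC.emits_concat hM hr⟩

theorem inevitable_fw_of_inevitable (hC : LC.IsFdb eqv) (hg : IsGoodPred LC eqv good) {p : P}
    {r : C} (h : Inevitable (SysStep LP LC) (fun x => good x.2) (p, r)) :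
    Inevitable (SysStep LP.FW LC) (fun x => good x.2) ((p, 0), r) := by
  obtain ⟨mbox, -, hmbox⟩ := hC.finite_mailbox
  refine Inevitable.of_simulation
    (fun x z => x.1.1 = z.1 ∧ LC.Emits eqv z.2 x.1.2 x.2) (fun x _ => (mbox x.2).card)
    ?_ ?_ ?_ h ⟨rfl, hC.emits_refl r⟩
  · rintro ⟨⟨p, M⟩, r⟩ ⟨_, r₀⟩ ⟨rfl, hM⟩ hz
    exact (hg.good_iff_of_emits hC.equivalence hM).1 hz
  · rintro ⟨⟨p, M⟩, r⟩ ⟨_, r₀⟩ ⟨rfl, hM⟩ ⟨⟨p', r₀'⟩, hz⟩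
    obtain ⟨K', r', hs, -⟩ := hz.fw_of_emits hC hM 0
    rw [zero_add] at hs
    exact Or.inl ⟨_, hs⟩
  · rintro ⟨⟨p, M⟩, r⟩ ⟨_, r₀⟩ ⟨⟨p', M'⟩, r'⟩ ⟨rfl, hM⟩ hx
    rcases hx.of_fw_of_emits hC hM with ⟨r₀', hs, hM'⟩ | ⟨rfl, ⟨a, ha⟩, hM'⟩
    · exact Or.inl ⟨_, hs, rfl, hM'⟩
    · refine Or.inr ⟨⟨rfl, hM'⟩, ?_⟩
      simp [hmbox _ _ _ ha]

theorem inevitable_of_inevitable_fw (hC : LC.IsFdb eqv) (hg : IsGoodPred LC eqv good) {p : P}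
    {r : C} (h : Inevitable (SysStep LP.FW LC) (fun x => good x.2) ((p, 0), r)) :
    Inevitable (SysStep LP LC) (fun x => good x.2) (p, r) := by
  refine Inevitable.of_simulation
    (fun x z => x.1 = z.1.1 ∧ LC.Emits eqv x.2 z.1.2 z.2) (fun _ _ => 0)
    ?_ ?_ ?_ h ⟨rfl, hC.emits_refl r⟩
  · rintro ⟨_, r₀⟩ ⟨⟨p, M⟩, r⟩ ⟨rfl, hM⟩ hz
    exact (hg.good_iff_of_emits hC.equivalence hM).2 hz
  · rintro ⟨_, r₀⟩ ⟨⟨p, M⟩, r⟩ ⟨rfl, hM⟩ ⟨⟨⟨p', M'⟩, r'⟩, hz⟩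
    rcases hz.of_fw_of_emits hC hM with ⟨r₀', hs, -⟩ | ⟨rfl, -, hM'⟩
    · exact Or.inl ⟨_, hs⟩
    · exact Or.inr ⟨_, hz, rfl, hM'⟩
  · rintro ⟨_, r₀⟩ ⟨⟨p, M⟩, r⟩ ⟨p', r₀'⟩ ⟨rfl, hM⟩ hx
    obtain ⟨K', r', hs, hK'⟩ := hx.fw_of_emits hC hM 0
    rw [zero_add] at hs
    exact Or.inl ⟨_, hs, by simp, by simpa using hK'⟩

theorem must_fw_iff (hC : LC.IsFdb eqv) (hg : IsGoodPred LC eqv good) {p : P} {r : C} :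
    Must LP.FW LC good (p, 0) r ↔ Must LP LC good p r := by
  rw [must_iff_inevitable, must_iff_inevitable]
  exact ⟨inevitable_of_inevitable_fw hC hg, inevitable_fw_of_inevitable hC hg⟩

/-- A server with forwarding passes a client as soon as it passes what is left of the client
when some outputs have been moved to the mailbox of the server. -/
theorem Inevitable.fw_of_emits (hC : LC.IsFdb eqv) (hg : IsGoodPred LC eqv good) {p : P}
    {M K : Multiset N} {r r' : C} (hK : LC.Emits eqv r K r')
    (h : Inevitable (SysStep LP.FW LC) (fun x => good x.2) ((p, M + K), r')) :
    Inevitable (SysStep LP.FW LC) (fun x => good x.2) ((p, M), r) := by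
  refine Inevitable.of_simulation
    (fun x z => ∃ K, z.1 = (x.1.1, x.1.2 + K) ∧ LC.Emits eqv x.2 K z.2)
    (fun x z => z.1.2.card - x.1.2.card) ?_ ?_ ?_ h ⟨K, rfl, hK⟩
  · rintro ⟨⟨p, M⟩, r⟩ ⟨_, r'⟩ ⟨K, rfl, hK⟩ hz
    exact (hg.good_iff_of_emits hC.equivalence hK).2 hz
  · rintro ⟨⟨p, M⟩, r⟩ ⟨_, r'⟩ ⟨K, rfl, hK⟩ ⟨z, hz⟩
    left
    cases hK with
    | cons hr _ => exact ⟨_, .com (μ := .inp _) .minp hr⟩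
    | refl he =>
      simp only [add_zero] at hz
      cases hz with
      | srv h => exact ⟨_, .srv h⟩
      | clt h =>
        obtain ⟨x, hx, -⟩ := hC.compatible _ _ _ _ he h
        exact ⟨_, .clt hx⟩
      | com hp h =>
        obtain ⟨x, hx, -⟩ := hC.compatible _ _ _ _ he h
        exact ⟨_, .com hp hx⟩
  · rintro ⟨⟨p, M⟩, r⟩ ⟨_, r'⟩ x' ⟨K, rfl, hK⟩ hx
    have lift : ∀ {p' : P} {r₁ : C}, SysStep LP LC (p, r) (p', r₁) →
        ∃ z', SysStep LP.FW LC ((p, M + K), r') z' ∧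
          ∃ K', z'.1 = (p', M + K') ∧ LC.Emits eqv r₁ K' z'.2 := by
      intro p' r₁ hs
      obtain ⟨K', x, hx, hK'⟩ := hs.fw_of_emits hC hK M
      exact ⟨_, hx, K', rfl, hK'⟩
    cases hx with
    | srv h =>
      change LTS.FWTr LP _ _ _ at h
      cases h with
      | proc h => exact Or.inl (lift (.srv h))
      | comm h =>
        rw [Multiset.cons_add]
        exact Or.inl ⟨_, .srv (.comm h), K, rfl, hK⟩
    | clt h => exact Or.inl (lift (.clt h))
    | com hp hr =>
      change LTS.FWTr LP _ _ _ at hp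
      cases hp with
      | proc hp => exact Or.inl (lift (.com hp hr))
      | @mout _ a M =>
        obtain ⟨x, hx, hK'⟩ := hC.exists_tr_vis_of_emits hK (by simp [VAct.co]) hr
        rw [Multiset.cons_add]
        exact Or.inl ⟨_, .com (μ := .out a) .mout hx, K, rfl, hK'⟩
      | @minp _ a M =>
        by_cases ha : a ∈ K
        · obtain ⟨K', rfl⟩ := Multiset.exists_cons_of_mem ha
          refine Or.inr ⟨⟨K', by simp, hC.emits_of_emits_cons hK hr⟩, ?_⟩
          simp only [Multiset.card_add, Multiset.card_cons]
          omega
        · obtain ⟨x, hx, hK'⟩ := hC.exists_tr_vis_of_emits hK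
            (fun b hb hab => ha (by cases hab; exact hb)) hr
          exact Or.inl ⟨_, .com (μ := .inp a) .minp hx, K, by simp, hK'⟩

end Forwarding

/-! ### The convergence of servers that pass a test -/

section Testing

variable {P C N : Type*} {LP : LTS P N} {LC : LTS C N} {good : C → Prop}

theorem Inevitable.converges {p : P} {r : C}
    (h : Inevitable (SysStep LP LC) (fun x => good x.2) (p, r)) (hr : ¬ good r) :
    LP.Converges p := by
  rw [LTS.converges_iff_acc]
  generalize hx : (p, r) = x at h
  induction h generalizing p with
  | now h =>
    subst hx
    exact absurd h hr
  | later _ _ ih =>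
    subst hx
    exact ⟨_, fun p' hp' => ih (p', r) (.srv hp') rfl⟩

theorem Inevitable.weak_nil {p p' : P} {r : C}
    (h : Inevitable (SysStep LP LC) (fun x => good x.2) (p, r)) (hr : ¬ good r)
    (hp : LP.Weak p [] p') : Inevitable (SysStep LP LC) (fun x => good x.2) (p', r) := by
  generalize ht : [] = t at hp
  induction hp with
  | refl => exact h
  | tau hp _ ih => exact ih (h.step hr (.srv hp)) ht
  | vis => cases ht

theorem Inevitable.weak_singleton {p p' : P} {r r' : C} {μ : VAct N}
    (h : Inevitable (SysStep LP LC) (fun x => good x.2) (p, r)) (hr : ¬ good r)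
    (hr' : ¬ good r') (hμ : LC.Tr r (.vis μ.co) r') (hp : LP.Weak p [μ] p') :
    Inevitable (SysStep LP LC) (fun x => good x.2) (p', r') := by
  obtain ⟨p₁, p₂, h₁, h₂, h₃⟩ := LTS.weak_singleton_iff.1 hp
  exact ((h.weak_nil hr h₁).step hr (.com h₂ hμ)).weak_nil hr' h₃

end Testing

/-! ### Soundness -/

section Soundness

variable {A B C N : Type*} {LA : LTS A N} {LB : LTS B N} {LC : LTS C N} {good : C → Prop}

/-- The acceptance-set preorder between a set of states, seen as their internal choice, and a
state. -/
def SetASLE (LA : LTS A N) (LB : LTS B N) (X : Set A) (q : B) : Prop :=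
  ∀ s : List (VAct N), (∀ p ∈ X, LA.ConvergesAlong p s) →
    LB.ConvergesAlong q s ∧ AccLE (⋃ p ∈ X, LA.acceptanceSet p s) (LB.acceptanceSet q s)

theorem ASLE.setASLE_singleton {p : A} {q : B} (h : ASLE LA LB p q) :
    SetASLE LA LB {p} q := by
  intro s hs
  have hs := hs p rfl
  exact ⟨h.1 s hs, by simpa using h.2 s hs⟩

theorem SetASLE.tau {X : Set A} {q q' : B} (h : SetASLE LA LB X q) (hq : LB.Tr q .tau q') :
    SetASLE LA LB X q' := by
  intro s hs
  obtain ⟨hc, ha⟩ := h s hs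
  refine ⟨hc.tau hq, ?_⟩
  rintro _ ⟨y, hy, hst, rfl⟩
  exact ha _ ⟨y, .tau hq hy, hst, rfl⟩

theorem SetASLE.vis {X : Set A} {q q' : B} {μ : VAct N} (h : SetASLE LA LB X q)
    (hX : ∀ p ∈ X, LA.Converges p) (hq : LB.Tr q (.vis μ) q') :
    SetASLE LA LB {p' | ∃ p ∈ X, LA.Weak p [μ] p'} q' := by
  intro s hs
  obtain ⟨hc, ha⟩ := h (μ :: s) fun p hp => .cons (hX p hp) fun p' hp' => hs p' ⟨p, hp, hp'⟩
  refine ⟨hc.vis hq, ?_⟩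
  rintro _ ⟨y, hy, hst, rfl⟩
  obtain ⟨Y, hY, hsub⟩ := ha _ ⟨y, .vis hq hy, hst, rfl⟩
  simp only [Set.mem_iUnion] at hY ⊢
  obtain ⟨p, hp, x, hx, hxs, rfl⟩ := hY
  obtain ⟨p', hp', hx'⟩ := LTS.weak_cons_iff.1 hx
  exact ⟨_, ⟨p', ⟨p, hp, hp'⟩, x, hx', hxs, rfl⟩, hsub⟩

theorem SetASLE.nonempty {X : Set A} {q : B} (h : SetASLE LA LB X q)
    (hX : ∀ p ∈ X, LA.Converges p) : X.Nonempty := by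
  obtain ⟨hc, ha⟩ := h [] fun p hp => .nil (hX p hp)
  obtain ⟨y, hy, hst⟩ := hc.converges.exists_stable
  obtain ⟨Y, hY, -⟩ := ha _ ⟨y, hy, hst, rfl⟩
  simp only [Set.mem_iUnion] at hY
  obtain ⟨p, hp, -⟩ := hY
  exact ⟨p, hp⟩

section Rank

variable {S : Type*} {R : S → S → Prop} {G : S → Prop}

theorem Inevitable.acc {x : S} (h : Inevitable R G x) : Acc (fun y x => ¬ G x ∧ R x y) x := by
  induction h with
  | now h => exact ⟨_, fun y hy => absurd h hy.1⟩
  | later _ _ ih => exact ⟨_, fun y hy => ih y hy.2⟩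

open Classical in
/-- The rank of the tree of the `R`-steps from `x` before a visit to `G`; it is `0` if that tree
is not well-founded. -/
noncomputable def stepRank (R : S → S → Prop) (G : S → Prop) (x : S) : Ordinal :=
  if h : Acc (fun y x => ¬ G x ∧ R x y) x then h.rank else 0

theorem Inevitable.stepRank_lt {x y : S} (h : Inevitable R G x) (hx : ¬ G x) (hxy : R x y) :
    stepRank R G y < stepRank R G x := by
  rw [stepRank, stepRank, dif_pos h.acc, dif_pos (h.step hx hxy).acc]
  exact h.acc.rank_lt_of_rel ⟨hx, hxy⟩

end Rank

theorem Inevitable.stepRank_le_of_weak_nil {p p' : A} {r : C}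
    (h : Inevitable (SysStep LA LC) (fun x => good x.2) (p, r)) (hr : ¬ good r)
    (hp : LA.Weak p [] p') :
    stepRank (SysStep LA LC) (fun x => good x.2) (p', r) ≤
      stepRank (SysStep LA LC) (fun x => good x.2) (p, r) := by
  generalize ht : [] = t at hp
  induction hp with
  | refl => exact le_rfl
  | tau hp _ ih =>
    exact (ih (h.step hr (.srv hp)) ht).trans (h.stepRank_lt hr (.srv hp)).le
  | vis => cases ht

/-- If all servers of a finite set pass a client, then so does every server above that set. The
induction is on a bound of the ranks of the set, which decreases whenever the client moves: a
finite set of ranks below `o` has a maximum below `o`. The moves of the server `q` alone are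
handled by its convergence. -/
theorem inevitable_of_setASLE (hfin : LA.ImageFinite) (o : Ordinal) :
    ∀ (X : Set A) (r : C), X.Finite →
      (∀ p ∈ X, Inevitable (SysStep LA LC) (fun x => good x.2) (p, r) ∧
        stepRank (SysStep LA LC) (fun x => good x.2) (p, r) ≤ o) →
      ∀ q : B, SetASLE LA LB X q →
        Inevitable (SysStep LB LC) (fun x => good x.2) (q, r) := by
  induction o using WellFoundedLT.induction with
  | _ o ih =>
  intro X r hXfin hX q hq
  by_cases hr : good r
  · exact .now hr
  have hconv : ∀ p ∈ X, LA.Converges p := fun p hp => (hX p hp).1.converges hr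
  have ih' : ∀ (X' : Set A) (r' : C) (q' : B), X'.Finite → X'.Nonempty →
      (∀ p ∈ X', Inevitable (SysStep LA LC) (fun x => good x.2) (p, r') ∧
        stepRank (SysStep LA LC) (fun x => good x.2) (p, r') < o) →
      SetASLE LA LB X' q' → Inevitable (SysStep LB LC) (fun x => good x.2) (q', r') := by
    intro X' r' q' hfin' hne hX' hq'
    obtain ⟨p₀, hp₀, hmax⟩ := Set.exists_max_image X'
      (fun p => stepRank (SysStep LA LC) (fun x => good x.2) (p, r')) hfin' hne
    exact ih _ (hX' p₀ hp₀).2 X' r' hfin' (fun p hp => ⟨(hX' p hp).1, hmax p hp⟩) q' hq'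
  have hqacc := LTS.converges_iff_acc.1
    (hq [] fun p hp => .nil (hconv p hp)).1.converges
  induction hqacc with
  | intro q _ ihq =>
  refine .later ?_ ?_
  -- If `q` and the client were deadlocked, so would be the client and a stable derivative of `X`
  -- whose ready set is included in that of `q`.
  · by_contra! hstuck
    obtain ⟨Y, hY, hsub⟩ := (hq [] fun p hp => .nil (hconv p hp)).2 _
      ⟨q, .refl q, fun q' hq' => hstuck _ (.srv hq'), rfl⟩
    simp only [Set.mem_iUnion] at hY
    obtain ⟨p, hp, x, hx, hxs, rfl⟩ := hY
    obtain ⟨⟨x', r'⟩, hstep⟩ := ((hX p hp).1.weak_nil hr hx).exists_step hr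
    cases hstep with
    | srv h => exact hxs _ h
    | clt h => exact hstuck _ (.clt h)
    | @com _ _ _ _ μ hμ h =>
      have hmem : μ ∈ LB.readySet q := by
        refine hsub ?_
        cases μ with
        | inp a => exact Or.inl ⟨a, x', rfl, hμ⟩
        | out a => exact Or.inr ⟨a, x', rfl, hμ⟩
      rcases hmem with ⟨a, q', rfl, hq'⟩ | ⟨a, q', rfl, hq'⟩
      · exact hstuck _ (.com hq' h)
      · exact hstuck _ (.com hq' h)
  · rintro ⟨q', r'⟩ hstep
    cases hstep with
    | srv h => exact ihq q' h (hq.tau h)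
    | clt h =>
      exact ih' X r' q hXfin (hq.nonempty hconv) (fun p hp =>
        ⟨(hX p hp).1.step hr (.clt h),
          ((hX p hp).1.stepRank_lt hr (.clt h)).trans_le (hX p hp).2⟩) hq
    | @com _ _ _ _ μ hμ h =>
      by_cases hr' : good r'
      · exact .now hr'
      have hconv' : ∀ p ∈ X, LA.ConvergesAlong p [μ] := fun p hp =>
        .cons (hconv p hp) fun p' hp' =>
          .nil (((hX p hp).1.weak_singleton hr hr' h hp').converges hr')
      have hq' := hq.vis hconv hμ
      -- After a communication, `q'` is compared with all weak derivatives of `X`.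
      refine ih' _ r' q' ?_ (hq'.nonempty ?_) ?_ hq'
      · have := hXfin.biUnion fun p hp => hfin.finite_weak_singleton (hconv' p hp)
        refine this.subset ?_
        rintro p' ⟨p, hp, hp'⟩
        exact Set.mem_biUnion hp hp'
      · rintro p' ⟨p, hp, hp'⟩
        exact ((hconv' p hp).weak hp').converges
      · rintro p' ⟨p, hp, hp'⟩
        refine ⟨(hX p hp).1.weak_singleton hr hr' h hp', ?_⟩
        obtain ⟨p₁, p₂, h₁, h₂, h₃⟩ := LTS.weak_singleton_iff.1 hp'
        have hp₁ := (hX p hp).1.weak_nil hr h₁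
        calc _ ≤ _ := (hp₁.step hr (.com h₂ h)).stepRank_le_of_weak_nil hr' h₃
          _ < _ := hp₁.stepRank_lt hr (.com h₂ h)
          _ ≤ _ := (hX p hp).1.stepRank_le_of_weak_nil hr h₁
          _ ≤ o := (hX p hp).2

/-- Soundness of the acceptance-set preorder, over an image-finite LTS of servers. -/
theorem ASLE.mustLE (hfin : LA.ImageFinite) {p : A} {q : B} (h : ASLE LA LB p q) :
    MustLE LA LB LC good p q := by
  intro r hr
  rw [must_iff_inevitable] at hr ⊢
  refine inevitable_of_setASLE hfin
    (stepRank (SysStep LA LC) (fun x => good x.2) (p, r)) {p} r (Set.finite_singleton p)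
    ?_ q h.setASLE_singleton
  rintro _ rfl
  exact ⟨hr, le_rfl⟩

end Soundness

/-! ### Completeness -/

section Completeness

variable {P C N : Type*} {LP : LTS P N} {LC : LTS C N} {eqv : C → C → Prop} {good : C → Prop}

theorem Inevitable.fw_of_eqv (hC : LC.IsFdb eqv) (hg : IsGoodPred LC eqv good)
    {x : P × Multiset N} {r r' : C} (he : eqv r r')
    (h : Inevitable (SysStep LP.FW LC) (fun x => good x.2) (x, r')) :
    Inevitable (SysStep LP.FW LC) (fun x => good x.2) (x, r) :=
  Inevitable.fw_of_emits (K := 0) hC hg (.refl he) (by simpa using h)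

/-- A generator `f` reduces the test `f s` to the test `f []` after `s`. The client `f (a :: s)`
has the output `ā` pending, and is left with `f s` when the forwarding server has taken it up. -/
theorem IsGenerator.inevitable (hC : LC.IsFdb eqv) (hg : IsGoodPred LC eqv good)
    {f : List (VAct N) → C} (hf : IsGenerator LC eqv good f) {s : List (VAct N)}
    {x : P × Multiset N} (hx : LP.FW.ConvergesAlong x s)
    (h : ∀ y, LP.FW.Weak x s y →
      Inevitable (SysStep LP.FW LC) (fun x => good x.2) (y, f [])) :
    Inevitable (SysStep LP.FW LC) (fun x => good x.2) (x, f s) := by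
  induction s generalizing x with
  | nil => exact h x (.refl x)
  | cons μ s ih =>
    cases μ with
    | inp a =>
      obtain ⟨p, M⟩ := x
      have hstep : LP.FW.Tr (p, M) (.vis (.inp a)) (p, a ::ₘ M) := .minp
      obtain ⟨r, hr, he⟩ := hf.co_step (.inp a) s
      refine Inevitable.fw_of_emits (K := {a}) hC hg (.cons hr (.refl he)) ?_
      rw [add_comm, Multiset.singleton_add]
      exact ih (hx.vis hstep) fun y hy => h y (.vis hstep hy)
    | out a =>
      have hacc := LTS.converges_iff_acc.1 hx.converges
      induction hacc with
      | intro x _ ihx =>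
      obtain ⟨r, hr⟩ := hf.out_tau a s
      refine .later ⟨_, .clt hr⟩ ?_
      rintro ⟨x', r'⟩ hstep
      cases hstep with
      | srv hx' => exact ihx x' hx' (hx.tau hx') fun y hy => h y (.tau hx' hy)
      | clt hr' => exact .now (hf.out_tau_good a s r' hr')
      | @com _ _ _ _ μ hx' hr' =>
        obtain ⟨hμ, he⟩ := hf.out_vis a s _ r' hr'
        cases μ with
        | inp b => cases hμ
        | out b =>
          cases hμ
          exact (ih (hx.vis hx') fun y hy => h y (.vis hx' hy)).fw_of_eqv hC hg he

theorem IsGenerator.convergesAlong_of_inevitable (hC : LC.IsFdb eqv)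
    (hg : IsGoodPred LC eqv good) {f : List (VAct N) → C} (hf : IsGenerator LC eqv good f)
    {s : List (VAct N)} {x : P × Multiset N}
    (h : Inevitable (SysStep LP.FW LC) (fun x => good x.2) (x, f s)) :
    LP.FW.ConvergesAlong x s ∧ ∀ y, LP.FW.Weak x s y →
      Inevitable (SysStep LP.FW LC) (fun x => good x.2) (y, f []) := by
  induction s generalizing x with
  | nil => exact ⟨.nil (h.converges (hf.not_good _)), fun y hy => h.weak_nil (hf.not_good _) hy⟩
  | cons μ s ih =>
    obtain ⟨r, hr, he⟩ := hf.co_step μ s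
    have key : ∀ x', LP.FW.Weak x [μ] x' →
        Inevitable (SysStep LP.FW LC) (fun x => good x.2) (x', f s) := fun x' hx' =>
      (h.weak_singleton (hf.not_good _) (fun hr' => hf.not_good s (hg.eqv_imp _ _ he hr')) hr
        hx').fw_of_eqv hC hg (hC.equivalence.symm he)
    refine ⟨.cons (h.converges (hf.not_good _)) fun x' hx' => (ih (key x' hx')).1, fun y hy => ?_⟩
    obtain ⟨x', hx', hy⟩ := LTS.weak_cons_iff.1 hy
    exact (ih (key x' hx')).2 y hy

theorem IsConvGenerator.inevitable_nil {LQ : LTS P N} {tc : List (VAct N) → C}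
    (ht : IsConvGenerator LC eqv good tc) {p : P} (hp : LQ.Converges p) :
    Inevitable (SysStep LQ LC) (fun x => good x.2) (p, tc []) := by
  rw [LTS.converges_iff_acc] at hp
  induction hp with
  | intro p _ ih =>
  obtain ⟨r, hr⟩ := ht.nil_tau
  refine .later ⟨_, .clt hr⟩ ?_
  rintro ⟨p', r'⟩ hstep
  cases hstep with
  | srv h => exact ih p' h
  | clt h => exact .now (ht.nil_tau_good r' h)
  | com _ h => exact absurd h (ht.nil_vis _ _)

/-- The test for acceptance is passed if every stable derivative offers an output in `E`. -/
theorem IsAccGenerator.inevitable_nil {LQ : LTS P N} {ta : List (VAct N) → Finset N → C}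
    (ht : IsAccGenerator LC eqv good ta) {E : Finset N} {p : P} (hp : LQ.Converges p)
    (hE : ∀ p', LQ.Weak p [] p' → LQ.Stable p' →
      ∃ a ∈ E, ∃ p'', LQ.Tr p' (.vis (.out a)) p'') :
    Inevitable (SysStep LQ LC) (fun x => good x.2) (p, ta [] E) := by
  rw [LTS.converges_iff_acc] at hp
  induction hp with
  | intro p _ ih =>
  refine .later ?_ ?_
  · by_cases hst : LQ.Stable p
    · obtain ⟨a, ha, p', hp'⟩ := hE p (.refl p) hst
      obtain ⟨r, hr⟩ := (ht.nil_inp E a).2 ha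
      exact ⟨_, .com hp' hr⟩
    · simp only [LTS.Stable, not_forall, not_not] at hst
      obtain ⟨p', hp'⟩ := hst
      exact ⟨_, .srv hp'⟩
  · rintro ⟨p', r'⟩ hstep
    cases hstep with
    | srv h => exact ih p' h fun y hy => hE y (.tau h hy)
    | clt h => exact absurd h (ht.nil_stable E _)
    | com _ h => exact .now (ht.nil_vis_good E _ _ h)

theorem LTS.IsFdb.finite_fw_outputs {S : Type*} {L : LTS S N} {eqv : S → S → Prop}
    (h : L.IsFdb eqv) (x : S × Multiset N) :
    {a | ∃ y, L.FW.Tr x (.vis (.out a)) y}.Finite := by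
  classical
  obtain ⟨mbox, hmbox, -⟩ := h.finite_mailbox
  refine (mbox x.1 + x.2).toFinset.finite_toSet.subset ?_
  rintro a ⟨y, hy⟩
  change LTS.FWTr L x _ y at hy
  cases hy with
  | proc hy => simpa using Or.inl ((hmbox _ _).2 ⟨_, hy⟩)
  | mout => simp

/-- Completeness of the acceptance-set preorder, for servers with forwarding. -/
theorem asle_fw_of_mustLE_fw {A B : Type*} {LA : LTS A N} {LB : LTS B N} {eqA : A → A → Prop}
    (hA : LA.IsFdb eqA) (hfin : LA.ImageFinite) (hC : LC.IsFdb eqv)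
    (hg : IsGoodPred LC eqv good) (hgen : HasClientGenerators LC eqv good)
    {x : A × Multiset N} {y : B × Multiset N} (h : MustLE LA.FW LB.FW LC good x y) :
    ASLE LA.FW LB.FW x y := by
  simp only [MustLE, must_iff_inevitable] at h
  obtain ⟨⟨tc, htc⟩, ta, hta⟩ := hgen
  constructor
  · intro s hs
    refine (htc.gen.convergesAlong_of_inevitable hC hg (h _ ?_)).1
    exact htc.gen.inevitable hC hg hs fun x' hx' => htc.inevitable_nil (hs.converges_of_weak hx')
  · rintro s hs _ ⟨y', hy', hst, rfl⟩
    by_contra! hno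
    -- Input is always possible with forwarding, so ready sets differ by outputs only.
    have hout : ∀ x', LA.FW.Weak x s x' → LA.FW.Stable x' →
        ∃ a, (∃ x'', LA.FW.Tr x' (.vis (.out a)) x'') ∧
          ¬ ∃ y'', LB.FW.Tr y' (.vis (.out a)) y'' := by
      intro x' hx' hx's
      have hsub := hno _ ⟨x', hx', hx's, rfl⟩
      rw [Set.not_subset] at hsub
      obtain ⟨μ, hμ, hμ'⟩ := hsub
      rcases hμ with ⟨a, x'', rfl, -⟩ | ⟨a, x'', rfl, hx''⟩
      · exact absurd (Or.inl ⟨a, (y'.1, a ::ₘ y'.2), rfl, .minp⟩) hμ'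
      · exact ⟨a, ⟨x'', hx''⟩, fun ⟨y'', hy''⟩ => hμ' (Or.inr ⟨a, y'', rfl, hy''⟩)⟩
    have hEfin : {a | (∃ x', LA.FW.Weak x s x' ∧ ∃ x'', LA.FW.Tr x' (.vis (.out a)) x'') ∧
        ¬ ∃ y'', LB.FW.Tr y' (.vis (.out a)) y''}.Finite := by
      have := (hfin.fw.finite_weak hs).biUnion fun x' _ => hA.finite_fw_outputs x'
      refine this.subset ?_
      rintro a ⟨⟨x', hx', hx''⟩, -⟩
      exact Set.mem_biUnion hx' hx''
    have hta' := (hta.gen hEfin.toFinset)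
    have hy := (hta'.convergesAlong_of_inevitable hC hg (h _ (hta'.inevitable hC hg hs
      fun x' hx' => hta.inevitable_nil (hs.converges_of_weak hx') fun x'' hx'' hxs => ?_))).2 y' hy'
    · obtain ⟨⟨y'', r⟩, hstep⟩ := hy.exists_step (hta'.not_good _)
      cases hstep with
      | srv h => exact hst _ h
      | clt h => exact hta.nil_stable _ _ h
      | @com _ _ _ _ μ hμ h =>
        cases μ with
        | inp a => exact hta.nil_out _ _ _ h
        | out a =>
          have ha := (hta.nil_inp _ a).1 ⟨_, h⟩
          rw [Set.Finite.mem_toFinset] at ha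
          exact ha.2 ⟨_, hμ⟩
    · have hx : LA.FW.Weak x s x'' := by simpa using hx'.append hx''
      obtain ⟨a, ha, ha'⟩ := hout x'' hx hxs
      refine ⟨a, ?_, ha⟩
      rw [Set.Finite.mem_toFinset]
      exact ⟨⟨x'', hx, ha⟩, ha'⟩

end Completeness

end AsyncMust

theorem mainTheorem1 {A B C N : Type*}
    (LA : AsyncMust.LTS A N) (LB : AsyncMust.LTS B N) (LC : AsyncMust.LTS C N)
    (eqA : A → A → Prop) (eqB : B → B → Prop) (eqC : C → C → Prop)
    (hA : LA.IsFdb eqA) (hB : LB.IsFdb eqB) (hC : LC.IsFdb eqC)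
    (hfin : LA.ImageFinite)
    (good : C → Prop) (hgood : AsyncMust.IsGoodPred LC eqC good)
    (p : A) (q : B) :
    (AsyncMust.ASLE LA.FW LB.FW (p, 0) (q, 0) → AsyncMust.MustLE LA LB LC good p q) ∧
    (AsyncMust.HasClientGenerators LC eqC good →
      (AsyncMust.MustLE LA LB LC good p q ↔ AsyncMust.ASLE LA.FW LB.FW (p, 0) (q, 0))) := by
  have hsound : AsyncMust.ASLE LA.FW LB.FW (p, 0) (q, 0) →
      AsyncMust.MustLE LA LB LC good p q := by
    intro h r hr
    rw [← AsyncMust.must_fw_iff hC hgood] at hr ⊢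
    exact h.mustLE hfin.fw r hr
  refine ⟨hsound, fun hgen => ⟨fun h => ?_, hsound⟩⟩
  refine AsyncMust.asle_fw_of_mustLE_fw hA hfin hC hgood hgen fun r hr => ?_
  rw [AsyncMust.must_fw_iff hC hgood] at hr ⊢
  exact h r hr
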